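/- Let $n\ge 3$ and let $\mathrm{Per}(\mathbb F_2^n)$ be the group of all permutations of the set $\mathbb F_2^n$. A $2$-flat in $\mathbb F_2^n$ is a coset $U+x$ of a $2$-dimensional linear subspace $U$ of $\mathbb F_2^n$. For $f\in\mathrm{Per}(\mathbb F_2^n)$ let $2\text{-coaffinity}(f)$ be the number of $2$-flats $X$ in $\mathbb F_2^n$ such that $f(X)$ is not a $2$-flat. Let $$\genfrac{[}{]}{0pt}{}{n-1}{2}_2=\frac{(2^{n-1}-1)(2^{n-2}-1)}{(2^2-1)(2^1-1)}$$ be the Gaussian binomial coefficient. Then the number of permutations $f\in\mathrm{Per}(\mathbb F_2^n)$ with $$2\text{-coaffinity}(f)=2^3\genfrac{[}{]}{0pt}{}{n-1}{2}_2=\tfrac83(2^{n-1}-1)(2^{n-2}-1)$$ is $$\begin{cases}2^{\frac12(n^2+3n-2)}\,(2^n-1)^2\prod_{j=1}^{n-1}(2^j-1)&\text{if } n\ge 4,\\[2pt] 2^6\cdot 3\cdot 7^2&\text{if } n=3.\end{cases}$$ -/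

import Mathlib

/-- `X` is a `k`-flat of the finite-dimensional vector space `V` over `K`: a coset `U + x` of a `k`-dimensional
linear subspace `U` of `V`. -/
def IsFlat (K : Type*) {V : Type*} [Field K] [AddCommGroup V] [Module K V] (k : ℕ)
    (X : Set V) : Prop :=
  ∃ (U : Submodule K V) (x : V), Module.finrank K U = k ∧ X = (fun u => u + x) '' (U : Set V)

/-- The `k`-coaffinity of a permutation `f` of the (finite) vector space `V`: the number of
`k`-flats `X` of `V` such that `f(X)` is not a `k`-flat. -/
noncomputable def coaffinity (K : Type*) {V : Type*} [Field K] [AddCommGroup V] [Module K V]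
    (k : ℕ) (f : Equiv.Perm V) : ℕ :=
  {X : Set V | IsFlat K k X ∧ ¬ IsFlat K k (f '' X)}.ncard

/-- The Gaussian binomial coefficient
`(q^n - 1)(q^(n-1) - 1) ⋯ (q^(n-k+1) - 1) / ((q^k - 1)(q^(k-1) - 1) ⋯ (q^1 - 1))`,
for `k ≤ n` and `2 ≤ q`. -/
def qBinom (q n k : ℕ) : ℚ :=
  (∏ i ∈ Finset.range k, ((q : ℚ) ^ (n - i) - 1)) /
    ∏ i ∈ Finset.range k, ((q : ℚ) ^ (k - i) - 1)

/-! Put N = 2^n. A 2-flat is a set of four points with sum zero, and each one carries 24 ordered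
triples of distinct points. Hence 24 times the coaffinity of f is its `defect`, the sum over
directions v of the number of ordered pairs at which D_v f(x) = f(x) + f(x+v) takes different
values. The prescribed coaffinity becomes defect 8(N-2)(N-4).

The directions with constant D_v f form a subgroup L of order ℓ. Any other direction contributes at
least 8(N-4), by injectivity (`four_le_of_injective`), and at least 4ℓ(N-2ℓ), because the fibres of
D_v f are unions of cosets of L + ⟨v⟩. For non-affine f of the prescribed defect these bounds force
ℓ = 2 and exactly 8(N-4) in each direction outside L (`linearity_eq_two`,
`disagreement_le_of_defect_le`).

For N > 12, each D_v f then has a majority value λ(v) with at most four exceptions. λ is additive,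
and f + λ is constant off at most two points, so f is an affine permutation times a transposition
(`eq_affine_mul_swap`). For N = 8 a direct argument with a basis gives an affine permutation times a
transposition (0 w) (`eq_affine_mul_swap_zero`). Conversely, all such products have the right defect
(`defect_affine_mul_swap`).

The factorisation is unique because an affine permutation fixing more than half of the points is
trivial. The count is |AGL(n,2)| times N(N-1)/2, or times 7 if n = 3. -/

open Finset

/-! ### Fibre sizes of functions with few disagreements -/

section Disagreement

variable {V W : Type*} [Fintype V] [DecidableEq W]

/-- The number of ordered pairs of points at which `h` takes different values. -/
def disagreement (h : V → W) : ℕ := ∑ x, #{y | h y ≠ h x}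

theorem card_fiber_add_card_compl (h : V → W) (α : W) :
    #{x | h x = α} + #{x | h x ≠ α} = Fintype.card V := by
  rw [card_filter_add_card_filter_not, card_univ]

theorem two_mul_le_disagreement (h : V → W) (α : W) :
    2 * (#{x | h x = α} * #{x | h x ≠ α}) ≤ disagreement h := by
  rw [disagreement, ← sum_filter_add_sum_filter_not univ (fun x => h x = α), two_mul]
  refine add_le_add ?_ ?_
  · rw [← smul_eq_mul]
    refine card_nsmul_le_sum _ _ _ fun x hx => ?_
    rw [(mem_filter.1 hx).2]
  · rw [mul_comm, ← smul_eq_mul]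
    refine card_nsmul_le_sum _ _ _ fun x hx => card_le_card fun y hy => ?_
    simp only [mem_filter, mem_univ, true_and] at hx hy ⊢
    rw [hy]
    exact fun e => hx e.symm

theorem card_mul_le_disagreement {h : V → W} {k : ℕ} (H : ∀ α, k ≤ #{x | h x ≠ α}) :
    Fintype.card V * k ≤ disagreement h := by
  rw [← card_univ, ← smul_eq_mul]
  exact card_nsmul_le_sum _ _ _ fun x _ => H (h x)

theorem disagreement_eq_zero_iff {h : V → W} : disagreement h = 0 ↔ ∀ x y, h x = h y := by
  simp only [disagreement, sum_eq_zero_iff, mem_univ, true_implies, card_eq_zero,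
    filter_eq_empty_iff, not_not]
  exact ⟨fun H x y => H y (x := x), fun H x y => H _ _⟩

/-- If some fibre has p ≥ 4 points, its complement has q ≥ 4 with p + q = N, and 2pq ≥ 8(N-4).
Otherwise all fibres have at most three points, and N(N-3) ≥ 8(N-4) since N² - 11N + 32 is positive.
-/
theorem le_disagreement {h : V → W} (hN : 4 ≤ Fintype.card V) (H : ∀ α, 4 ≤ #{x | h x ≠ α}) :
    8 * (Fintype.card V - 4) ≤ disagreement h := by
  obtain ⟨N, hN'⟩ := Nat.exists_eq_add_of_le hN
  by_cases hp : ∃ α, 4 ≤ #{x | h x = α}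
  · obtain ⟨α, hα⟩ := hp
    refine le_trans ?_ (two_mul_le_disagreement h α)
    have h1 := H α
    have h2 := card_fiber_add_card_compl h α
    obtain ⟨p, hp⟩ := Nat.exists_eq_add_of_le hα
    obtain ⟨q, hq⟩ := Nat.exists_eq_add_of_le h1
    rw [← h2, hp, hq, show 4 + p + (4 + q) - 4 = 4 + p + q by omega]
    nlinarith [Nat.zero_le (p * q)]
  · push Not at hp
    refine le_trans ?_ (card_mul_le_disagreement (k := Fintype.card V - 3) fun α => ?_)
    · rw [hN', show 4 + N - 4 = N by omega, show 4 + N - 3 = N + 1 by omega]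
      rcases Nat.lt_or_ge N 2 with h | h
      · interval_cases N <;> norm_num
      · obtain ⟨M, rfl⟩ := Nat.exists_eq_add_of_le h
        nlinarith [Nat.zero_le (M * M)]
    · have h1 := hp α
      have h2 := card_fiber_add_card_compl h α
      omega

/-- Near-converse of `le_disagreement`. Otherwise all complements have at least five points. A fibre
with at least five points then gives 2pq ≥ 10(N-5) with N ≥ 10, too large; if all fibres have at
most four, N(N-4) exceeds 8(N-4) because N > 8. -/
theorem exists_card_le_four {h : V → W} (hN : 8 < Fintype.card V)
    (hle : disagreement h ≤ 8 * (Fintype.card V - 4)) :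
    ∃ α, #{x | h x ≠ α} ≤ 4 := by
  by_contra! hc
  obtain ⟨N, hN'⟩ := Nat.exists_eq_add_of_le hN
  by_cases hp : ∃ α, 5 ≤ #{x | h x = α}
  · obtain ⟨α, hα⟩ := hp
    have h0 := two_mul_le_disagreement h α
    have h1 := hc α
    have h2 := card_fiber_add_card_compl h α
    obtain ⟨p, hp⟩ := Nat.exists_eq_add_of_le hα
    obtain ⟨q, hq⟩ := Nat.exists_eq_add_of_le h1
    have h3 := h0.trans hle
    rw [← h2, hp, hq, show 5 + p + (4 + 1 + q) - 4 = 6 + p + q by omega] at h3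
    nlinarith [Nat.zero_le (p * q)]
  · push Not at hp
    have h0 := card_mul_le_disagreement (h := h) (k := Fintype.card V - 4) fun α => by
      have h1 := hp α
      have h2 := card_fiber_add_card_compl h α
      omega
    have h3 := h0.trans hle
    rw [hN', show 8 + 1 + N - 4 = N + 5 by omega] at h3
    nlinarith

/-- A function with few disagreements is constant up to two points. -/
theorem exists_card_le_two {h : V → W} (hN : 8 ≤ Fintype.card V)
    (hle : disagreement h ≤ 4 * (Fintype.card V - 2)) : ∃ α, #{x | h x ≠ α} ≤ 2 := by
  by_contra! hc
  obtain ⟨N, hN'⟩ := Nat.exists_eq_add_of_le hN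
  by_cases hp : ∃ α, 3 ≤ #{x | h x = α}
  · obtain ⟨α, hα⟩ := hp
    have h0 := two_mul_le_disagreement h α
    have h1 := hc α
    have h2 := card_fiber_add_card_compl h α
    obtain ⟨p, hp⟩ := Nat.exists_eq_add_of_le hα
    obtain ⟨q, hq⟩ := Nat.exists_eq_add_of_le h1
    have h3 := h0.trans hle
    rw [← h2, hp, hq, show 3 + p + (2 + 1 + q) - 2 = 4 + p + q by omega] at h3
    nlinarith [Nat.zero_le (p * q)]
  · push Not at hp
    have h0 := card_mul_le_disagreement (h := h) (k := Fintype.card V - 2) fun α => by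
      have h1 := hp α
      have h2 := card_fiber_add_card_compl h α
      omega
    have h3 := h0.trans hle
    rw [hN', show 8 + N - 2 = N + 6 by omega] at h3
    nlinarith

end Disagreement

/-! ### Differences and linear structures in characteristic two -/

section Difference

variable {V : Type*} [AddCommGroup V] [Module (ZMod 2) V]

theorem add_self_two (x : V) : x + x = 0 := ZModModule.add_self x

/-- The difference of `f` at `x` in the direction `v`; in characteristic two, plus is minus. -/
def difference (f : V → V) (v x : V) : V := f x + f (x + v)

/-- The directions in which all differences of `f` are constant. -/
def linearStructures (f : V → V) : AddSubgroup V where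
  carrier := {v | ∀ x y, difference f v x = difference f v y}
  zero_mem' x y := by simp [difference, add_self_two]
  add_mem' {u v} hu hv x y := by
    have h1 := hu x y
    have h2 := hv (x + u) (y + u)
    simp only [difference, ← add_assoc] at h1 h2 ⊢
    grind [add_self_two (f (x + u)), add_self_two (f (y + u))]
  neg_mem' {u} hu := by rwa [ZModModule.neg_eq_self]

theorem mem_linearStructures {f : V → V} {v : V} :
    v ∈ linearStructures f ↔ ∀ x y, difference f v x = difference f v y := Iff.rfl

theorem difference_add_self (f : V → V) (v x : V) :
    difference f v (x + v) = difference f v x := by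
  rw [difference, difference, add_assoc, add_self_two, add_zero, add_comm]

theorem difference_add_of_mem {f : V → V} {l : V} (hl : l ∈ linearStructures f) (v x : V) :
    difference f v (x + l) = difference f v x := by
  have h := hl x (x + v)
  simp only [difference] at h ⊢
  rw [add_right_comm x l v]
  grind [add_self_two (f (x + v)), add_self_two (f (x + l)), add_self_two (f (x + v + l))]

/-- Maps preserving sums of three elements, that is, affine maps over the field of two elements. -/
def PreservesTripleSums (f : V → V) : Prop := ∀ x y z, f (x + y + z) = f x + f y + f z

theorem preservesTripleSums_iff {f : V → V} :
    PreservesTripleSums f ↔ linearStructures f = ⊤ := by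
  rw [AddSubgroup.eq_top_iff']
  constructor
  · intro H v x y
    have h := H x v (x + y)
    rw [show x + v + (x + y) = y + v by grind [add_self_two x]] at h
    have h' := H x v 0
    have h'' := H x y 0
    have h3 := H x (x + y) 0
    rw [show x + (x + y) + 0 = y by grind [add_self_two x]] at h3
    simp only [difference]
    rw [add_zero] at h'
    grind [add_self_two (f x), add_self_two (f 0), add_self_two (f (x + y))]
  · intro H x y z
    have h := H y x (x + z)
    simp only [difference] at h
    rw [show x + z + y = x + y + z by abel] at h
    have h' := H z x 0
    simp only [difference, zero_add] at h'
    have h3 := H y x 0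
    simp only [difference, zero_add] at h3
    grind [add_self_two (f (x + z)), add_self_two (f 0), add_self_two (f x), add_self_two (f y),
      add_self_two (f (x + y))]

end Difference

/-! ### Lower bounds for the defect -/

section Defect

variable {V : Type*} [AddCommGroup V] [Module (ZMod 2) V] [Fintype V]

open Classical in
/-- The number of directions in which all differences of `f` are constant. -/
noncomputable def linearity (f : V → V) : ℕ := #{v | v ∈ linearStructures f}

open Classical in
theorem card_compl_linearStructures (f : V → V) :
    #{v | v ∉ linearStructures f} = Fintype.card V - linearity f := by
  have := card_filter_add_card_filter_not (s := univ) (fun v => v ∈ linearStructures f)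
  rw [card_univ] at this
  rw [linearity]
  omega

open Classical in
theorem linearity_pos (f : V → V) : 0 < linearity f :=
  card_pos.2 ⟨0, mem_filter.2 ⟨mem_univ _, zero_mem _⟩⟩

variable [DecidableEq V]

/-- The number of parallelograms `x, x + v, y, y + v` on which `f` has a non-zero sum. -/
def defect (f : V → V) : ℕ := ∑ v, disagreement (difference f v)

/-- The exceptional set is stable under translation by v, so with fewer than four points it is a
single pair {a, a+v}. The point z with f(z) = f(a) + α lies outside this pair, whence f(z+v) = f(a),
and injectivity gives z = a+v, a contradiction. -/
theorem four_le_of_injective {f : V → V} (hf : Function.Injective f) (hN : 4 ≤ Fintype.card V)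
    {v : V} (hv : v ∉ linearStructures f) (α : V) : 4 ≤ #{x | difference f v x ≠ α} := by
  by_contra! hlt
  have hv0 : v ≠ 0 := fun h => hv (h ▸ zero_mem _)
  have hadd : ∀ x, x + v ≠ x := fun x h => hv0 (by simpa using h)
  have hE : ∃ a, difference f v a ≠ α := by
    by_contra! h
    exact hv fun x y => (h x).trans (h y).symm
  obtain ⟨a, ha⟩ := hE
  have hout : ∀ b, b ≠ a → b ≠ a + v → difference f v b = α := by
    intro b hb1 hb2
    by_contra hb
    have hb3 : b + v ≠ a := fun h => hb2 (by grind [add_self_two v])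
    have hsub : ({a, a + v, b, b + v} : Finset V) ⊆ ({x | difference f v x ≠ α} : Finset V) := by
      intro x hx
      simp only [mem_insert, mem_singleton] at hx
      rw [mem_filter]
      refine ⟨mem_univ _, ?_⟩
      rcases hx with rfl | rfl | rfl | rfl <;> simpa only [difference_add_self]
    have hc : #({a, a + v, b, b + v} : Finset V) = 4 := by
      have := hadd a
      have := hadd b
      have h5 : a + v ≠ b + v := fun h => hb1 (add_right_cancel h).symm
      rw [card_insert_of_notMem, card_insert_of_notMem, card_pair] <;> grind
    have := card_le_card hsub
    omega
  -- α = 0 would give f(b+v) = f(b) at any b outside the pair.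
  have hα : α ≠ 0 := by
    rintro rfl
    obtain ⟨b, hb⟩ : ∃ b, b ∉ ({a, a + v} : Finset V) := by
      by_contra! h
      have h1 : #({a, a + v} : Finset V) = Fintype.card V := by
        rw [eq_univ_iff_forall.2 h, card_univ]
      have := card_le_two (a := a) (b := a + v)
      omega
    simp only [mem_insert, mem_singleton, not_or] at hb
    have h := hout b hb.1 hb.2
    rw [difference] at h
    have h' : f (b + v) = f b := by grind [add_self_two (f b)]
    exact hadd b (hf h')
  obtain ⟨z, hz⟩ := (Finite.injective_iff_surjective.1 hf) (f a + α)
  by_cases h1 : z = a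
  · subst h1
    exact hα (by simpa using hz)
  by_cases h2 : z = a + v
  · subst h2
    apply ha
    rw [difference, hz]
    grind [add_self_two (f a)]
  · have h3 := hout z h1 h2
    rw [difference, hz] at h3
    have h4 : f (z + v) = f a := by grind [add_self_two (f a)]
    have h5 := hf h4
    exact h2 (by grind [add_self_two v])

-- D_v f is invariant under translation by L and by v, so its fibre through a contains the disjoint
-- cosets a + L and a + v + L.
open Classical in
theorem two_mul_linearity_le {f : V → V} {v : V} (hv : v ∉ linearStructures f) (a : V) :
    2 * linearity f ≤ #{x | difference f v x = difference f v a} := by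
  set L : Finset V := {v | v ∈ linearStructures f} with hL
  have hdisj : Disjoint (L.image (a + ·)) (L.image (a + v + ·)) := by
    rw [disjoint_left]
    intro x h1 h2
    obtain ⟨l, hl, rfl⟩ := mem_image.1 h1
    obtain ⟨m, hm, h⟩ := mem_image.1 h2
    rw [hL, mem_filter] at hl hm
    refine hv ?_
    have : v = l - m := by grind
    exact this ▸ sub_mem hl.2 hm.2
  have hcard : #(L.image (a + ·) ∪ L.image (a + v + ·)) = 2 * #L := by
    rw [card_union_of_disjoint hdisj, card_image_of_injective _ (add_right_injective a),
      card_image_of_injective _ (add_right_injective (a + v)), two_mul]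
  rw [linearity, ← hL, ← hcard]
  refine card_le_card fun x hx => ?_
  rw [mem_filter]
  refine ⟨mem_univ _, ?_⟩
  rcases mem_union.1 hx with hx | hx
  · obtain ⟨l, hl, rfl⟩ := mem_image.1 hx
    exact difference_add_of_mem (mem_filter.1 hl).2 v a
  · obtain ⟨l, hl, rfl⟩ := mem_image.1 hx
    rw [difference_add_of_mem (mem_filter.1 hl).2 v (a + v), difference_add_self]

theorem exists_fibers {f : V → V} {v : V} (hv : v ∉ linearStructures f) :
    ∃ α, 2 * linearity f ≤ #{x | difference f v x = α} ∧
      2 * linearity f ≤ #{x | difference f v x ≠ α} := by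
  rw [mem_linearStructures] at hv
  push Not at hv
  obtain ⟨a, b, hab⟩ := hv
  have hv' : v ∉ linearStructures f := fun h => hab (h a b)
  refine ⟨_, two_mul_linearity_le hv' a, (two_mul_linearity_le hv' b).trans ?_⟩
  refine card_le_card fun x hx => ?_
  rw [mem_filter] at hx ⊢
  exact ⟨mem_univ _, hx.2.trans_ne hab.symm⟩

theorem four_mul_linearity_le {f : V → V} {v : V} (hv : v ∉ linearStructures f) :
    4 * linearity f ≤ Fintype.card V := by
  obtain ⟨α, h1, h2⟩ := exists_fibers hv
  have := card_fiber_add_card_compl (difference f v) α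
  omega

theorem le_disagreement_difference {f : V → V} {v : V} (hv : v ∉ linearStructures f) :
    4 * linearity f * (Fintype.card V - 2 * linearity f) ≤ disagreement (difference f v) := by
  obtain ⟨α, h1, h2⟩ := exists_fibers hv
  have h3 := card_fiber_add_card_compl (difference f v) α
  refine le_trans ?_ (two_mul_le_disagreement _ α)
  obtain ⟨p, hp⟩ := Nat.exists_eq_add_of_le h1
  obtain ⟨q, hq⟩ := Nat.exists_eq_add_of_le h2
  rw [← h3, hp, hq, show ∀ a : ℕ, a + p + (a + q) - a = a + p + q by omega]
  nlinarith [Nat.zero_le (p * q)]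

open Classical in
theorem defect_eq_sum (f : V → V) :
    defect f = ∑ v with v ∉ linearStructures f, disagreement (difference f v) := by
  rw [defect, ← sum_filter_add_sum_filter_not univ (fun v => v ∈ linearStructures f)]
  rw [sum_eq_zero, zero_add]
  intro v hv
  exact disagreement_eq_zero_iff.2 (mem_filter.1 hv).2

theorem card_mul_le_defect {f : V → V} {k : ℕ}
    (H : ∀ v, v ∉ linearStructures f → k ≤ disagreement (difference f v)) :
    (Fintype.card V - linearity f) * k ≤ defect f := by
  classical
  rw [defect_eq_sum, ← card_compl_linearStructures, ← smul_eq_mul]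
  exact card_nsmul_le_sum _ _ _ fun v hv => H v (mem_filter.1 hv).2

/-- If ℓ = 1, the N-1 other directions contribute at least 8(N-4) each, which is too much. If ℓ ≥ 3,
then N ≥ 4ℓ, and (N-ℓ)·4ℓ(N-2ℓ) already exceeds 8(N-2)(N-4). The latter is the value of the same
expression at ℓ = 2. -/
theorem linearity_eq_two {f : V → V} (hf : Function.Injective f) (hna : ¬ PreservesTripleSums f)
    (hN : Fintype.card V = 8 ∨ 12 ≤ Fintype.card V)
    (hle : defect f ≤ 8 * (Fintype.card V - 2) * (Fintype.card V - 4)) : linearity f = 2 := by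
  obtain ⟨v, hv⟩ : ∃ v, v ∉ linearStructures f := by
    by_contra! h
    exact hna (preservesTripleSums_iff.2 ((AddSubgroup.eq_top_iff' _).2 h))
  have h4 := four_mul_linearity_le hv
  have hpos := linearity_pos f
  have h8 : 8 ≤ Fintype.card V := by omega
  by_contra hne
  rcases Nat.lt_or_ge (linearity f) 2 with h | h
  · have h1 : linearity f = 1 := by omega
    have h2 := (card_mul_le_defect fun v hv =>
      le_disagreement (by omega) (four_le_of_injective hf (by omega) hv)).trans hle
    rw [h1] at h2
    obtain ⟨N, hN'⟩ := Nat.exists_eq_add_of_le h8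
    rw [hN', show 8 + N - 4 = N + 4 by omega, show 8 + N - 2 = N + 6 by omega,
      show 8 + N - 1 = N + 7 by omega] at h2
    nlinarith
  · have h3 : 3 ≤ linearity f := by omega
    have h12 : 12 ≤ Fintype.card V := by omega
    have h2 := (card_mul_le_defect fun v hv => le_disagreement_difference hv).trans hle
    obtain ⟨q, hq⟩ := Nat.exists_eq_add_of_le h3
    obtain ⟨r, hr⟩ := Nat.exists_eq_add_of_le h4
    rw [hr, hq, show 4 * (3 + q) + r - (3 + q) = 9 + 3 * q + r by omega,
      show 4 * (3 + q) + r - 2 * (3 + q) = 6 + 2 * q + r by omega,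
      show 4 * (3 + q) + r - 2 = 10 + 4 * q + r by omega,
      show 4 * (3 + q) + r - 4 = 8 + 4 * q + r by omega] at h2
    nlinarith [Nat.zero_le (q * r), Nat.zero_le (q * q), Nat.zero_le (q * q * q),
      Nat.zero_le (q * q * r), Nat.zero_le (q * r * r), Nat.zero_le (r * r)]

/-- Exactly N-2 directions lie outside L, each contributing at least 8(N-4); the bound on the total
leaves no room for excess. -/
theorem disagreement_le_of_defect_le {f : V → V} (hf : Function.Injective f)
    (hN : 4 ≤ Fintype.card V) (hL : linearity f = 2)
    (hle : defect f ≤ 8 * (Fintype.card V - 2) * (Fintype.card V - 4)) (v : V) :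
    disagreement (difference f v) ≤ 8 * (Fintype.card V - 4) := by
  classical
  by_cases hv : v ∈ linearStructures f
  · rw [disagreement_eq_zero_iff.2 hv]
    exact Nat.zero_le _
  by_contra! hlt
  have h := sum_lt_sum (s := ({v | v ∉ linearStructures f} : Finset V))
    (f := fun _ => 8 * (Fintype.card V - 4)) (g := fun v => disagreement (difference f v))
    (fun u hu => le_disagreement hN (four_le_of_injective hf hN (mem_filter.1 hu).2))
    ⟨v, mem_filter.2 ⟨mem_univ _, hv⟩, hlt⟩
  rw [← defect_eq_sum, sum_const, card_compl_linearStructures, hL, smul_eq_mul] at h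
  rw [mul_comm 8, mul_assoc] at hle
  omega

end Defect

/-! ### Permutations of minimal positive defect -/

section Classification

variable {V : Type*} [AddCommGroup V] [Module (ZMod 2) V]

/-- The group of affine permutations. -/
def affinePerms (V : Type*) [AddCommGroup V] [Module (ZMod 2) V] :
    Subgroup (Equiv.Perm V) where
  carrier := {f | PreservesTripleSums f}
  one_mem' _ _ _ := rfl
  mul_mem' {f g} hf hg x y z := by
    simp only [Equiv.Perm.coe_mul, Function.comp_apply]
    rw [hg x y z, hf]
  inv_mem' {f} hf x y z := by
    apply f.injective
    rw [hf]
    simp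

theorem mem_affinePerms {f : Equiv.Perm V} : f ∈ affinePerms V ↔ PreservesTripleSums f := Iff.rfl

variable [Fintype V] [DecidableEq V]

/-- An affine permutation fixing more than half of the points is the identity. -/
theorem eq_one_of_fixes {A : Equiv.Perm V} (hA : A ∈ affinePerms V) {E : Finset V}
    (hE : 2 * #E < Fintype.card V) (hfix : ∀ x, x ∉ E → A x = x) : A = 1 := by
  ext x
  have hE' : #E < Fintype.card V := by omega
  obtain ⟨y, hy⟩ : ∃ y, y ∉ E := by
    by_contra! h
    rw [eq_univ_iff_forall.2 h, card_univ] at hE'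
    omega
  -- This makes x the sum of the three fixed points y, z and x + y + z.
  obtain ⟨z, hz⟩ : ∃ z, z ∉ E ∪ E.image (x + y + ·) := by
    by_contra! h
    have h1 := card_union_le E (E.image (x + y + ·))
    rw [eq_univ_iff_forall.2 h, card_univ] at h1
    have := card_image_le (s := E) (f := (x + y + ·))
    omega
  rw [mem_union, not_or] at hz
  have hz2 : x + y + z ∉ E := fun h => hz.2
    (mem_image.2 ⟨_, h, by grind [add_self_two x, add_self_two y]⟩)
  have h := hA y z (x + y + z)
  rw [hfix y hy, hfix z hz.1, hfix _ hz2] at h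
  rw [show y + z + (x + y + z) = x by grind [add_self_two z, add_self_two y]] at h
  simpa using h

omit [Module (ZMod 2) V] in
theorem disagreement_eq_sum_translations (g : V → V) :
    disagreement g = ∑ v, #{x | g (x + v) ≠ g x} := by
  simp only [disagreement, card_filter]
  conv_rhs => rw [sum_comm]
  refine sum_congr rfl fun x _ => ?_
  exact (Equiv.sum_comp (Equiv.addLeft x) (fun y => if g y ≠ g x then 1 else 0)).symm

/-- The majority difference in each direction depends additively on the direction. -/
theorem majority_add {f lam : V → V} (hN : 12 < Fintype.card V)
    (hlam : ∀ v, #{x | difference f v x ≠ lam v} ≤ 4) (u v : V) :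
    lam (u + v) = lam u + lam v := by
  set E : V → Finset V := fun v => {x | difference f v x ≠ lam v} with hE
  -- Three sets of at most four points cannot cover more than twelve. At x all three majorities
  -- hold, and D_{u+v} f(x) = D_u f(x) + D_v f(x+u).
  obtain ⟨x, hx⟩ : ∃ x, x ∉ E u ∪ (E v).image (· + u) ∪ E (u + v) := by
    by_contra! h
    have h1 := card_union_le (E u ∪ (E v).image (· + u)) (E (u + v))
    have h2 := card_union_le (E u) ((E v).image (· + u))
    rw [eq_univ_iff_forall.2 h, card_univ] at h1
    have h3 := card_image_le (s := E v) (f := (· + u))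
    have : #(E u) ≤ 4 := hlam u
    have : #(E v) ≤ 4 := hlam v
    have : #(E (u + v)) ≤ 4 := hlam (u + v)
    omega
  simp only [mem_union, not_or] at hx
  obtain ⟨⟨h1, h2⟩, h3⟩ := hx
  have h2' : x + u ∉ E v := fun h => h2 (mem_image.2 ⟨_, h, by grind [add_self_two u]⟩)
  simp only [hE, mem_filter, mem_univ, true_and, not_not] at h1 h2' h3
  rw [← h1, ← h2', ← h3]
  simp only [difference, add_assoc]
  grind [add_self_two (f (x + u))]

/-- For each direction v, f + λ changes between x and x + v only if x is exceptional for v. That is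
at most four points, and none if v lies in L, where D_v f is constantly λ(v). -/
theorem disagreement_add_majority_le {f lam : V → V} (hN : 4 < Fintype.card V)
    (hlam : ∀ v, #{x | difference f v x ≠ lam v} ≤ 4)
    (hadd : ∀ u v, lam (u + v) = lam u + lam v) (hL : linearity f = 2) :
    disagreement (fun x => f x + lam x) ≤ 4 * (Fintype.card V - 2) := by
  classical
  have hset : ∀ v x, f (x + v) + lam (x + v) ≠ f x + lam x → difference f v x ≠ lam v := by
    intro v x h h'
    apply h
    rw [hadd, ← h', difference]
    grind [add_self_two (f x), add_self_two (f (x + v))]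
  rw [disagreement_eq_sum_translations,
    ← sum_filter_add_sum_filter_not univ (fun v => v ∈ linearStructures f), sum_eq_zero, zero_add]
  · rw [← hL, ← card_compl_linearStructures, mul_comm, ← smul_eq_mul]
    refine sum_le_card_nsmul _ _ _ fun v _ => (card_le_card fun x hx => ?_).trans (hlam v)
    exact mem_filter.2 ⟨mem_univ _, hset v x (mem_filter.1 hx).2⟩
  · intro v hv
    rw [card_eq_zero, filter_eq_empty_iff]
    intro x _ hx
    have h1 := hset v x hx
    have h2 : ({x | difference f v x ≠ lam v} : Finset V) = univ := by
      rw [eq_univ_iff_forall]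
      intro y
      rw [mem_filter]
      exact ⟨mem_univ _, fun h => h1 (((mem_filter.1 hv).2 x y).trans h)⟩
    have h3 := hlam v
    rw [h2, card_univ] at h3
    omega

/-- Off a set E of at most two points f agrees with A = λ + α. So A⁻¹f moves at most two points, and
it is not the identity as f is not affine. -/
theorem eq_affine_mul_swap {f : Equiv.Perm V} (hna : f ∉ affinePerms V)
    (hN : 12 < Fintype.card V)
    (hle : defect f ≤ 8 * (Fintype.card V - 2) * (Fintype.card V - 4)) :
    ∃ A ∈ affinePerms V, ∃ t : Equiv.Perm V, t.IsSwap ∧ A * t = f := by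
  have hL := linearity_eq_two f.injective hna (Or.inr hN.le) hle
  choose lam hlam using fun v => exists_card_le_four (by omega)
    (disagreement_le_of_defect_le f.injective (by omega) hL hle v)
  have hadd := majority_add hN hlam
  obtain ⟨α, hα⟩ := exists_card_le_two (by omega)
    (disagreement_add_majority_le (by omega) hlam hadd hL)
  set E : Finset V := {x | f x + lam x ≠ α} with hE
  have hout : ∀ x, x ∉ E → f x = lam x + α := by
    intro x hx
    simp only [hE, mem_filter, mem_univ, true_and, not_not] at hx
    rw [← hx]
    grind [add_self_two (lam x)]
  have hinj : Function.Injective fun x => lam x + α := by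
    intro x y hxy
    by_contra hne
    have hxy' : lam x = lam y := add_right_cancel hxy
    -- If λ(x) = λ(y), then f, which is λ + α off E, takes equal values at z and z + x + y.
    obtain ⟨z, hz⟩ : ∃ z, z ∉ E ∪ E.image (· + (x + y)) := by
      by_contra! h
      have h1 := card_union_le E (E.image (· + (x + y)))
      rw [eq_univ_iff_forall.2 h, card_univ] at h1
      have := card_image_le (s := E) (f := (· + (x + y)))
      omega
    rw [mem_union, not_or] at hz
    have hz2 : z + (x + y) ∉ E := fun h => hz.2
      (mem_image.2 ⟨_, h, by grind [add_self_two x, add_self_two y]⟩)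
    have h : f (z + (x + y)) = f z := by
      rw [hout _ hz.1, hout _ hz2, hadd, hadd, hxy', add_self_two, add_zero]
    have h0 : x + y = 0 := by simpa using f.injective h
    exact hne (by grind [add_self_two y])
  set A : Equiv.Perm V := Equiv.ofBijective _ (Finite.injective_iff_bijective.1 hinj) with hAdef
  have hA : A ∈ affinePerms V := by
    intro x y z
    change lam (x + y + z) + α = lam x + α + (lam y + α) + (lam z + α)
    rw [hadd, hadd]
    grind [add_self_two α]
  refine ⟨A, hA, A⁻¹ * f, ?_, by group⟩
  have hsupp : (A⁻¹ * f).support ⊆ E := by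
    intro x hx
    by_contra hxE
    rw [Equiv.Perm.mem_support] at hx
    apply hx
    rw [Equiv.Perm.mul_apply, Equiv.Perm.inv_eq_iff_eq]
    exact hout x hxE
  rw [← Equiv.Perm.card_support_eq_two]
  have h1 := card_le_card hsupp
  have h2 := Equiv.Perm.card_support_ne_one (A⁻¹ * f)
  have h3 : #(A⁻¹ * f).support ≠ 0 := by
    rw [Ne, Equiv.Perm.card_support_eq_zero]
    intro h
    rw [inv_mul_eq_one] at h
    exact hna (h ▸ hA)
  omega

-- Since w is a linear structure, D_u f depends only on the class modulo ⟨w, u⟩. There are at most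
-- two classes, those of 0 and v, and the sum condition equates the two values. By symmetry v is a
-- linear structure too, and these form a subgroup.
omit [Fintype V] [DecidableEq V] in
theorem preservesTripleSums_of_basis {f : V → V} {u v w c : V}
    (hcov : ∀ x, x = 0 ∨ x = w ∨ x = u ∨ x = u + w ∨ x = v ∨ x = v + w ∨ x = u + v ∨ x = u + v + w)
    (hw : ∀ x, f (x + w) = f x + c) (hsum : f 0 + f u + f v + f (u + v) = 0) :
    PreservesTripleSums f := by
  have hwL : w ∈ linearStructures f := fun x y => by
    rw [difference, difference, hw, hw]
    grind [add_self_two (f x), add_self_two (f y)]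
  have key : ∀ u v : V, (∀ x, x = 0 ∨ x = w ∨ x = u ∨ x = u + w ∨ x = v ∨ x = v + w ∨ x = u + v ∨
      x = u + v + w) → f 0 + f u + f v + f (u + v) = 0 → u ∈ linearStructures f := by
    intro u v hcov hsum
    have hv : difference f u v = difference f u 0 := by
      rw [difference, difference, zero_add, add_comm v u]
      grind [add_self_two (f v), add_self_two (f (u + v))]
    have h0 : ∀ x, difference f u x = difference f u 0 := by
      intro x
      have hW := difference_add_of_mem hwL u
      have hU := difference_add_self f u
      have hu0 : difference f u u = difference f u 0 := by simpa using hU 0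
      rcases hcov x with rfl | rfl | rfl | rfl | rfl | rfl | rfl | rfl
      · rfl
      · simpa using hW 0
      · exact hu0
      · rw [hW, hu0]
      · exact hv
      · rw [hW, hv]
      · rw [add_comm u v, hU, hv]
      · rw [hW, add_comm u v, hU, hv]
    exact fun x y => (h0 x).trans (h0 y).symm
  have hu := key u v hcov hsum
  have hv := key v u (fun x => by have := hcov x; rw [add_comm v u]; tauto)
    (by rw [add_comm v u, add_right_comm (f 0)]; exact hsum)
  rw [preservesTripleSums_iff, AddSubgroup.eq_top_iff']
  intro x
  rcases hcov x with rfl | rfl | rfl | rfl | rfl | rfl | rfl | rfl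
  · exact zero_mem _
  · exact hwL
  · exact hu
  · exact add_mem hu hwL
  · exact hv
  · exact add_mem hv hwL
  · exact add_mem hu hv
  · exact add_mem (add_mem hu hv) hwL

/-- A space with eight elements has a basis extending a given non-zero vector. -/
theorem exists_basis_of_card_eq_eight (hN : Fintype.card V = 8) {w : V} (hw : w ≠ 0) :
    ∃ u v : V, u ≠ 0 ∧ v ≠ 0 ∧ u ≠ v ∧ u ≠ w ∧ v ≠ w ∧ u + v ≠ w ∧ ∀ x, x = 0 ∨ x = w ∨ x = u ∨
      x = u + w ∨ x = v ∨ x = v + w ∨ x = u + v ∨ x = u + v + w := by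
  have hex : ∀ E : Finset V, #E < 8 → ∃ x, x ∉ E := by
    intro E hE
    by_contra! h
    rw [eq_univ_iff_forall.2 h, card_univ] at hE
    omega
  obtain ⟨u, hu⟩ := hex {0, w} (card_le_two.trans_lt (by norm_num))
  obtain ⟨v, hv⟩ := hex {0, w, u, u + w} (card_le_four.trans_lt (by norm_num))
  simp only [mem_insert, mem_singleton, not_or] at hu hv
  obtain ⟨hu0, huw⟩ := hu
  obtain ⟨hv0, hvw, hvu, hvuw⟩ := hv
  have huvw : u + v ≠ w := fun h => hvuw (by grind [add_self_two u])
  refine ⟨u, v, hu0, hv0, Ne.symm hvu, huw, hvw, huvw, ?_⟩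
  have huv0 : u + v ≠ 0 := fun h => hvu (by grind [add_self_two u])
  have huw0 : u + w ≠ 0 := fun h => huw (by grind [add_self_two w])
  have hvw0 : v + w ≠ 0 := fun h => hvw (by grind [add_self_two w])
  have huvw0 : u + v + w ≠ 0 := fun h => huvw (by grind [add_self_two w])
  have hcard : #({0, w, u, u + w, v, v + w, u + v, u + v + w} : Finset V) = 8 := by
    rw [card_insert_of_notMem, card_insert_of_notMem, card_insert_of_notMem,
      card_insert_of_notMem, card_insert_of_notMem, card_insert_of_notMem, card_pair]
    all_goals try simp only [mem_insert, mem_singleton, not_or]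
    all_goals grind [add_self_two w, add_self_two v, add_self_two u]
  have huniv : ({0, w, u, u + w, v, v + w, u + v, u + v + w} : Finset V) = univ := by
    rw [← card_eq_iff_eq_univ, hcard, hN]
  intro x
  simpa only [mem_insert, mem_singleton] using eq_univ_iff_forall.1 huniv x

/-- Take w ≠ 0 in L, with f(x+w) = f(x) + c. The sum of f over {0, u, v, u+v} is then c; composing
with (0 w) changes f(0) to f(0) + c, so the sum becomes 0 and the composite is affine. -/
theorem eq_affine_mul_swap_zero {f : Equiv.Perm V} (hna : f ∉ affinePerms V)
    (hN : Fintype.card V = 8)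
    (hle : defect f ≤ 8 * (Fintype.card V - 2) * (Fintype.card V - 4)) :
    ∃ A ∈ affinePerms V, ∃ w : V, w ≠ 0 ∧ A * Equiv.swap 0 w = f := by
  classical
  have hL := linearity_eq_two f.injective hna (Or.inl hN) hle
  obtain ⟨w, hwL, hw0⟩ : ∃ w ∈ linearStructures f, w ≠ 0 := by
    rw [linearity] at hL
    obtain ⟨a, ha, b, hb, hab⟩ := one_lt_card.1 (hL.symm ▸ one_lt_two)
    by_cases h : a = 0
    · exact ⟨b, (mem_filter.1 hb).2, fun hb => hab (h.trans hb.symm)⟩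
    · exact ⟨a, (mem_filter.1 ha).2, h⟩
  obtain ⟨c, hc⟩ : ∃ c, ∀ x, f (x + w) = f x + c := by
    refine ⟨difference f w 0, fun x => ?_⟩
    rw [← hwL x 0, difference]
    grind [add_self_two (f x)]
  obtain ⟨u, v, hu0, hv0, huv, huw, hvw, huvw, hcov⟩ := exists_basis_of_card_eq_eight hN hw0
  have inj := f.injective
  have hne : f 0 + f u + f v + f (u + v) ≠ 0 := fun h =>
    hna (preservesTripleSums_of_basis hcov hc h)
  have hsum : f 0 + f u + f v + f (u + v) = c := by
    obtain ⟨z, hz⟩ := f.surjective (f 0 + f u + f v)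
    have hcw := hc 0
    rw [zero_add] at hcw
    -- Injectivity rules out every z except u + v, where the sum is 0 and f would be affine, and u +
    -- v + w, where the sum is c.
    rcases hcov z with h0 | h0 | h0 | h0 | h0 | h0 | h0 | h0 <;> rw [h0] at hz
    · exact absurd (inj (by grind [add_self_two (f v)] : f u = f v)) huv
    · have h : f u = f (v + w) := by rw [hc]; grind [add_self_two (f v)]
      exact absurd (inj h) fun h => huvw (by grind [add_self_two v])
    · exact absurd (inj (by grind [add_self_two (f v)] : f 0 = f v)) hv0.symm
    · have h : f v = f w := by rw [hc] at hz; grind [add_self_two (f 0)]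
      exact absurd (inj h) hvw
    · exact absurd (inj (by grind [add_self_two (f 0)] : f 0 = f u)) hu0.symm
    · have h : f u = f w := by rw [hc] at hz; grind [add_self_two (f 0)]
      exact absurd (inj h) huw
    · exact absurd (by grind [add_self_two (f (u + v))]) hne
    · rw [hc] at hz
      grind [add_self_two (f (u + v))]
  refine ⟨f * Equiv.swap 0 w, ?_, w, hw0, by rw [mul_assoc, Equiv.swap_mul_self, mul_one]⟩
  refine preservesTripleSums_of_basis (u := u) (v := v) (w := w) (c := c) hcov ?_ ?_
  · intro x
    simp only [Equiv.Perm.mul_apply]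
    have hw := hc 0
    rw [zero_add] at hw
    by_cases hx0 : x = 0
    · subst hx0
      rw [zero_add, Equiv.swap_apply_left, Equiv.swap_apply_right, hw]
      grind [add_self_two c]
    by_cases hxw : x = w
    · subst hxw
      rw [add_self_two, Equiv.swap_apply_left, Equiv.swap_apply_right, hw]
    · rw [Equiv.swap_apply_of_ne_of_ne hx0 hxw, Equiv.swap_apply_of_ne_of_ne, hc]
      · exact fun h => hxw (by grind [add_self_two w])
      · simpa using hx0
  · simp only [Equiv.Perm.mul_apply]
    have hw := hc 0
    rw [zero_add] at hw
    rw [Equiv.swap_apply_left, Equiv.swap_apply_of_ne_of_ne hu0 huw,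
      Equiv.swap_apply_of_ne_of_ne hv0 hvw, Equiv.swap_apply_of_ne_of_ne _ huvw, hw]
    · grind [add_self_two c]
    · exact fun h => huv (by grind [add_self_two v])

omit [AddCommGroup V] [Module (ZMod 2) V] in
theorem disagreement_ite {W : Type*} [DecidableEq W] {α β : W} (hαβ : α ≠ β) (S : Finset V) :
    disagreement (fun x => if x ∈ S then β else α) = 2 * (#S * (Fintype.card V - #S)) := by
  have h1 : ∀ x ∈ S, #{y | (if y ∈ S then β else α) ≠ if x ∈ S then β else α} =
      Fintype.card V - #S := by
    intro x hx
    rw [← card_compl]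
    congr 1
    ext y
    by_cases hy : y ∈ S <;> simp [hx, hy, hαβ]
  have h2 : ∀ x ∈ Sᶜ, #{y | (if y ∈ S then β else α) ≠ if x ∈ S then β else α} = #S := by
    intro x hx
    congr 1
    ext y
    by_cases hy : y ∈ S <;> simp [mem_compl.1 hx, hy, hαβ.symm]
  rw [disagreement, ← sum_add_sum_compl S, sum_congr rfl h1, sum_congr rfl h2, sum_const,
    sum_const, card_compl, smul_eq_mul, smul_eq_mul]
  ring

/-- The swap adds A(a) + A(b) to the values at a and b. For v outside {0, a+b} this shifts D_v on
the four points a, b, a+v, b+v and gives 2·4·(N-4) disagreements. For v = a+b the two shifts cancel.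
-/
theorem defect_affine_mul_swap {A : Equiv.Perm V} (hA : A ∈ affinePerms V) {a b : V} (hab : a ≠ b) :
    defect (A * Equiv.swap a b) = 8 * (Fintype.card V - 2) * (Fintype.card V - 4) := by
  have hab0 : a + b ≠ 0 := fun h => hab (by grind [add_self_two b])
  have hdiff : ∀ x v, A x + A (x + v) = A v + A 0 := by
    intro x v
    have := hA x v 0
    rw [add_zero] at this
    rw [this]
    grind [add_self_two (A x)]
  have happ : ∀ x, (A * Equiv.swap a b) x =
      if x = a ∨ x = b then A x + (A a + A b) else A x := by
    intro x
    rw [Equiv.Perm.mul_apply]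
    by_cases h1 : x = a
    · subst h1
      rw [Equiv.swap_apply_left, if_pos (Or.inl rfl)]
      grind [add_self_two (A x)]
    by_cases h2 : x = b
    · subst h2
      rw [Equiv.swap_apply_right, if_pos (Or.inr rfl)]
      grind [add_self_two (A x)]
    · rw [Equiv.swap_apply_of_ne_of_ne h1 h2, if_neg (by tauto)]
  have hdis : ∀ v, disagreement (difference (A * Equiv.swap a b) v) =
      if v ∈ ({0, a + b} : Finset V)ᶜ then 8 * (Fintype.card V - 4) else 0 := by
    intro v
    by_cases hv : v ∈ ({0, a + b} : Finset V)
    · rw [if_neg (by rwa [mem_compl, not_not]), disagreement_eq_zero_iff]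
      rw [mem_insert, mem_singleton] at hv
      rcases hv with rfl | rfl
      · intro x y
        simp [difference, add_self_two]
      · have h : ∀ x, difference (A * Equiv.swap a b) (a + b) x = A (a + b) + A 0 := by
          intro x
          rw [← hdiff x, difference, happ, happ]
          have e : (x + (a + b) = a ∨ x + (a + b) = b) ↔ (x = a ∨ x = b) := by
            constructor
            · rintro (h | h)
              · right; grind [add_self_two b]
              · left; grind [add_self_two a]
            · rintro (h | h)
              · right; grind [add_self_two a]
              · left; grind [add_self_two b]
          by_cases hx : x = a ∨ x = b
          · rw [if_pos hx, if_pos (e.2 hx)]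
            grind [add_self_two (A a), add_self_two (A b)]
          · rw [if_neg hx, if_neg (mt e.1 hx)]
        exact fun x y => (h x).trans (h y).symm
    · rw [if_pos (mem_compl.2 hv)]
      rw [mem_insert, mem_singleton, not_or] at hv
      obtain ⟨hv0, hvab⟩ := hv
      have hne : A v + A 0 ≠ A v + A 0 + (A a + A b) := fun h => hab (A.injective
        (by grind [add_self_two (A b)]))
      have hS : difference (A * Equiv.swap a b) v = fun x =>
          if x ∈ ({a, b, a + v, b + v} : Finset V) then A v + A 0 + (A a + A b)
            else A v + A 0 := by
        funext x
        rw [← hdiff x, difference, happ, happ]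
        simp only [mem_insert, mem_singleton]
        have e1 : x + v = a ↔ x = a + v :=
          ⟨fun h => by grind [add_self_two v], fun h => by grind [add_self_two v]⟩
        have e2 : x + v = b ↔ x = b + v :=
          ⟨fun h => by grind [add_self_two v], fun h => by grind [add_self_two v]⟩
        by_cases hx : x = a ∨ x = b
        · have hx' : ¬ (x = a + v ∨ x = b + v) := by
            rintro (h | h) <;> rcases hx with rfl | rfl
            · exact hv0 (by simpa using h)
            · exact hvab (by grind [add_self_two a])
            · exact hvab (by grind [add_self_two b])
            · exact hv0 (by simpa using h)
          rw [if_pos hx, if_neg (by rwa [e1, e2]), if_pos (by tauto)]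
          abel
        · by_cases hx' : x = a + v ∨ x = b + v
          · rw [if_neg hx, if_pos (by rwa [e1, e2]), if_pos (by tauto)]
            abel
          · rw [if_neg hx, if_neg (by rwa [e1, e2]), if_neg (by tauto)]
      have hc : #({a, b, a + v, b + v} : Finset V) = 4 := by
        have h1 : a ≠ a + v := by simpa using hv0
        have h2 : b ≠ b + v := by simpa using hv0
        have h3 : a ≠ b + v := fun h => hvab (by grind [add_self_two b])
        have h4 : b ≠ a + v := fun h => hvab (by grind [add_self_two a])
        rw [card_insert_of_notMem, card_insert_of_notMem, card_pair] <;> grind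
      rw [hS, disagreement_ite hne, hc]
      ring
  rw [defect, sum_congr rfl fun v _ => hdis v, ← sum_filter, filter_mem_eq_inter, univ_inter,
    sum_const, card_compl, card_pair hab0.symm, smul_eq_mul]
  ring

theorem defect_eq_zero_of_mem {A : Equiv.Perm V} (hA : A ∈ affinePerms V) : defect A = 0 := by
  refine sum_eq_zero fun v _ => disagreement_eq_zero_iff.2 ?_
  have h := preservesTripleSums_iff.1 (mem_affinePerms.1 hA)
  exact (AddSubgroup.eq_top_iff' _).1 h v

theorem notMem_affinePerms {f : Equiv.Perm V} (hN : 8 ≤ Fintype.card V)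
    (h : defect f = 8 * (Fintype.card V - 2) * (Fintype.card V - 4)) : f ∉ affinePerms V := by
  intro hf
  rw [defect_eq_zero_of_mem hf, eq_comm, mul_eq_zero, mul_eq_zero] at h
  omega

end Classification

/-! ### Planes as quadruples with sum zero, and the defect as 24 times the coaffinity -/

section Flats

variable {V : Type*} [AddCommGroup V] [Module (ZMod 2) V] [DecidableEq V]

omit [AddCommGroup V] [Module (ZMod 2) V] in
theorem sum_quadruple {M : Type*} [AddCommMonoid M] (f : V → M) {a b c d : V} (hab : a ≠ b)
    (hac : a ≠ c) (had : a ≠ d) (hbc : b ≠ c) (hbd : b ≠ d) (hcd : c ≠ d) :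
    ∑ x ∈ {a, b, c, d}, f x = f a + f b + f c + f d := by
  rw [sum_insert (by simp [*]), sum_insert (by simp [*]), sum_pair hcd]
  abel

omit [DecidableEq V] in
theorem fourth_ne {a b c : V} (hab : a ≠ b) (hac : a ≠ c) (hbc : b ≠ c) :
    a ≠ a + b + c ∧ b ≠ a + b + c ∧ c ≠ a + b + c :=
  ⟨fun h => hbc (by grind [add_self_two c]), fun h => hac (by grind [add_self_two c]),
    fun h => hab (by grind [add_self_two b])⟩

theorem card_quadruple {a b c : V} (hab : a ≠ b) (hac : a ≠ c) (hbc : b ≠ c) :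
    #({a, b, c, a + b + c} : Finset V) = 4 := by
  obtain ⟨h1, h2, h3⟩ := fourth_ne hab hac hbc
  rw [card_insert_of_notMem (by simp [*]), card_insert_of_notMem (by simp [*]), card_pair h3]

theorem sum_quadruple_eq_zero {a b c : V} (hab : a ≠ b) (hac : a ≠ c) (hbc : b ≠ c) :
    ∑ x ∈ ({a, b, c, a + b + c} : Finset V), x = 0 := by
  obtain ⟨h1, h2, h3⟩ := fourth_ne hab hac hbc
  rw [sum_quadruple (fun x => x) hab hac h1 hbc h2 h3, add_self_two]

theorem eq_quadruple {S : Finset V} (hS : #S = 4) (hsum : ∑ x ∈ S, x = 0) {a b c : V}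
    (ha : a ∈ S) (hb : b ∈ S) (hc : c ∈ S) (hab : a ≠ b) (hac : a ≠ c) (hbc : b ≠ c) :
    S = {a, b, c, a + b + c} := by
  have h3 : #({a, b, c} : Finset V) = 3 := card_eq_three.2 ⟨a, b, c, hab, hac, hbc, rfl⟩
  have hsub : ({a, b, c} : Finset V) ⊆ S := by
    simp only [insert_subset_iff, singleton_subset_iff]
    exact ⟨ha, hb, hc⟩
  have hd : #(S \ {a, b, c}) = 1 := by rw [card_sdiff_of_subset hsub, hS, h3]
  obtain ⟨d, hd⟩ := card_eq_one.1 hd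
  have hs := sum_sdiff (f := fun x : V => x) hsub
  rw [hd, sum_singleton, hsum, sum_insert (by simp [*]), sum_pair hbc] at hs
  have hd' : d = a + b + c := by grind [add_self_two d]
  have : d ∈ S := sdiff_subset (hd ▸ mem_singleton_self d)
  refine (eq_of_subset_of_card_le ?_ ?_).symm
  · simp only [insert_subset_iff, singleton_subset_iff]
    exact ⟨ha, hb, hc, hd' ▸ this⟩
  · rw [card_quadruple hab hac hbc, hS]

/-- The planes over the field of two elements are the sets of four elements with sum zero. -/
theorem isFlat_two_iff {S : Finset V} :
    IsFlat (ZMod 2) 2 (S : Set V) ↔ #S = 4 ∧ ∑ x ∈ S, x = 0 := by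
  have h01 : ∀ r : ZMod 2, r = 0 ∨ r = 1 := by decide
  constructor
  · rintro ⟨U, x, hU, hS⟩
    have : Module.Finite (ZMod 2) U := Module.finite_of_finrank_eq_succ hU
    let b := Module.finBasisOfFinrankEq (ZMod 2) U hU
    have hb0 : (b 0 : V) ≠ 0 := fun h => b.ne_zero 0 (Subtype.ext h)
    have hb1 : (b 1 : V) ≠ 0 := fun h => b.ne_zero 1 (Subtype.ext h)
    have hb01 : (b 0 : V) ≠ b 1 := fun h => absurd (b.injective (Subtype.ext h)) (by decide)
    have h1 : x ≠ b 0 + x := by simpa using hb0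
    have h2 : x ≠ b 1 + x := by simpa using hb1
    have h3 : (b 0 : V) + x ≠ b 1 + x := by simpa using hb01
    have hS' : S = {x, b 0 + x, b 1 + x, x + (b 0 + x) + (b 1 + x)} := by
      have e : x + (b 0 + x) + (b 1 + x) = (b 0 + b 1 : V) + x := by grind [add_self_two x]
      rw [e, ← coe_inj, hS]
      ext y
      simp only [Set.mem_image, SetLike.mem_coe, coe_insert, coe_singleton, Set.mem_insert_iff,
        Set.mem_singleton_iff]
      constructor
      · rintro ⟨u, hu, rfl⟩
        have hr := congrArg Subtype.val (b.sum_repr ⟨u, hu⟩)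
        rw [Fin.sum_univ_two] at hr
        simp only [Submodule.coe_add, Submodule.coe_smul] at hr
        rw [← hr]
        rcases h01 (b.repr ⟨u, hu⟩ 0) with h | h <;> rcases h01 (b.repr ⟨u, hu⟩ 1) with h' | h' <;>
          simp [h, h']
      · rintro (rfl | rfl | rfl | rfl)
        · exact ⟨0, U.zero_mem, zero_add _⟩
        · exact ⟨_, (b 0).2, rfl⟩
        · exact ⟨_, (b 1).2, rfl⟩
        · exact ⟨_, U.add_mem (b 0).2 (b 1).2, rfl⟩
    rw [hS']
    exact ⟨card_quadruple h1 h2 h3, sum_quadruple_eq_zero h1 h2 h3⟩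
  · rintro ⟨hS, hsum⟩
    obtain ⟨a, ha, b, hb, c, hc, hab, hac, hbc⟩ := two_lt_card.1 (show 2 < #S by omega)
    have hS' := eq_quadruple hS hsum ha hb hc hab hac hbc
    have hu : a + b ≠ 0 := fun h => hab (by grind [add_self_two b])
    have hv : a + c ≠ 0 := fun h => hac (by grind [add_self_two c])
    have huv : a + b + (a + c) ≠ 0 := fun h => hbc (by grind [add_self_two a, add_self_two c])
    have hli : LinearIndependent (ZMod 2) ![a + b, a + c] := by
      rw [LinearIndependent.pair_iff]
      intro s t hst
      rcases h01 s with rfl | rfl <;> rcases h01 t with rfl | rfl <;> simp_all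
    refine ⟨Submodule.span (ZMod 2) {a + b, a + c}, a, ?_, ?_⟩
    · have := finrank_span_eq_card hli
      rwa [Matrix.range_cons, Matrix.range_cons, Matrix.range_empty, Set.union_empty,
        Set.singleton_union, Fintype.card_fin] at this
    · rw [hS']
      ext y
      simp only [Set.mem_image, SetLike.mem_coe, coe_insert, coe_singleton, Set.mem_insert_iff,
        Set.mem_singleton_iff, Submodule.mem_span_pair]
      have e1 : a + b + a = b := by grind [add_self_two a]
      have e2 : a + c + a = c := by grind [add_self_two a]
      have e3 : a + b + (a + c) + a = a + b + c := by grind [add_self_two a]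
      constructor
      · rintro (rfl | rfl | rfl | rfl)
        · exact ⟨0, ⟨0, 0, by simp⟩, zero_add _⟩
        · exact ⟨a + y, ⟨1, 0, by simp⟩, e1⟩
        · exact ⟨a + y, ⟨0, 1, by simp⟩, e2⟩
        · exact ⟨_, ⟨1, 1, by simp⟩, e3⟩
      · rintro ⟨u, ⟨r, s, rfl⟩, rfl⟩
        rcases h01 r with rfl | rfl <;> rcases h01 s with rfl | rfl <;> simp [e1, e2, e3]

variable [Fintype V]

theorem coaffinity_eq_card (f : Equiv.Perm V) :
    coaffinity (ZMod 2) 2 f =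
      #{S : Finset V | (#S = 4 ∧ ∑ x ∈ S, x = 0) ∧ ∑ x ∈ S, f x ≠ 0} := by
  rw [coaffinity, ← Set.ncard_coe_finset, ← Set.ncard_image_of_injective _ coe_injective]
  congr 1
  ext X
  have key : ∀ S : Finset V, (IsFlat (ZMod 2) 2 (S : Set V) ∧ ¬ IsFlat (ZMod 2) 2 (f '' S)) ↔
      (#S = 4 ∧ ∑ x ∈ S, x = 0) ∧ ∑ x ∈ S, f x ≠ 0 := by
    intro S
    rw [← coe_image, isFlat_two_iff, isFlat_two_iff, card_image_of_injective _ f.injective,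
      sum_image (fun x _ y _ h => f.injective h)]
    tauto
  constructor
  · intro hX
    obtain ⟨S, rfl⟩ : ∃ S : Finset V, (S : Set V) = X := ⟨X.toFinite.toFinset, by simp⟩
    exact ⟨S, mem_filter.2 ⟨mem_univ _, (key S).1 hX⟩, rfl⟩
  · rintro ⟨S, hS, rfl⟩
    exact (key S).2 (mem_filter.1 hS).2

theorem defect_eq_card (f : V → V) :
    defect f = #{t : V × V × V | f t.1 + f t.2.1 + f t.2.2 + f (t.1 + t.2.1 + t.2.2) ≠ 0} := by
  rw [card_filter, ← univ_product_univ, sum_product]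
  simp only [← univ_product_univ, sum_product, defect, disagreement, card_filter]
  rw [sum_comm]
  refine sum_congr rfl fun x _ => ?_
  -- The direction v is replaced by the vertex b = x + v, so that the fourth vertex y + v becomes x
  -- + b + y.
  rw [← Equiv.sum_comp (Equiv.addLeft x)]
  refine sum_congr rfl fun b _ => sum_congr rfl fun y _ => ?_
  have e1 : x + (x + b) = b := by grind [add_self_two x]
  have e2 : y + (x + b) = x + b + y := by abel
  congr 1
  simp only [Equiv.coe_addLeft, difference, e1, e2, eq_iff_iff]
  refine not_congr ⟨fun h => ?_, fun h => ?_⟩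
  · grind [add_self_two (f x), add_self_two (f b)]
  · grind [add_self_two (f x), add_self_two (f b)]

omit [AddCommGroup V] [Module (ZMod 2) V] in
theorem card_distinct_triples {S : Finset V} (hS : #S = 4) :
    #{t : V × V × V | (t.1 ∈ S ∧ t.2.1 ∈ S ∧ t.2.2 ∈ S) ∧ t.1 ≠ t.2.1 ∧ t.1 ≠ t.2.2 ∧
      t.2.1 ≠ t.2.2} = 24 := by
  have h : #(S.sigma fun a => (S.erase a).sigma fun b => (S.erase a).erase b) = 24 := by
    rw [card_sigma, sum_congr rfl fun a ha => card_sigma (S.erase a) _,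
      sum_congr rfl fun a ha => sum_congr rfl fun b hb => card_erase_of_mem hb]
    simp only [sum_const, smul_eq_mul]
    rw [sum_congr rfl fun a ha => by rw [card_erase_of_mem ha], sum_const, hS]
    norm_num
  rw [← h]
  refine card_nbij' (fun t => ⟨t.1, t.2.1, t.2.2⟩) (fun t => (t.1, t.2.1, t.2.2)) ?_ ?_ ?_ ?_
  · rintro ⟨a, b, c⟩
    simp
    tauto
  · rintro ⟨a, b, c⟩
    simp
    tauto
  · rintro ⟨a, b, c⟩ _
    rfl
  · rintro ⟨a, b, c⟩ _
    rfl

/-- Triples with a repeated entry have sum zero and do not count. Every other triple spans a unique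
plane, and each plane arises from 4·3·2 triples. -/
theorem defect_eq_mul_coaffinity (f : Equiv.Perm V) :
    defect f = 24 * coaffinity (ZMod 2) 2 f := by
  rw [defect_eq_card, coaffinity_eq_card, mul_comm, ← smul_eq_mul, ← sum_const]
  have hdist : ∀ a b c : V, f a + f b + f c + f (a + b + c) ≠ 0 → a ≠ b ∧ a ≠ c ∧ b ≠ c := by
    intro a b c h
    refine ⟨?_, ?_, ?_⟩
    · rintro rfl
      apply h
      rw [add_self_two, zero_add, add_self_two, zero_add, add_self_two]
    · rintro rfl
      apply h
      rw [add_right_comm a b a, add_self_two, zero_add, add_right_comm (f a), add_self_two,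
        zero_add, add_self_two]
    · rintro rfl
      apply h
      rw [add_assoc a, add_self_two, add_zero, add_assoc (f a), add_self_two, add_zero,
        add_self_two]
  rw [card_eq_sum_card_fiberwise (f := fun t : V × V × V =>
    ({t.1, t.2.1, t.2.2, t.1 + t.2.1 + t.2.2} : Finset V))
    (t := {S : Finset V | (#S = 4 ∧ ∑ x ∈ S, x = 0) ∧ ∑ x ∈ S, f x ≠ 0})]
  · refine sum_congr rfl fun S hS => ?_
    obtain ⟨⟨hS4, hS0⟩, hSf⟩ := (mem_filter.1 hS).2
    rw [← card_distinct_triples hS4, filter_filter]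
    congr 1
    ext ⟨a, b, c⟩
    simp only [mem_filter, mem_univ, true_and]
    constructor
    · rintro ⟨h, rfl⟩
      exact ⟨by simp, hdist a b c h⟩
    · rintro ⟨⟨ha, hb, hc⟩, hab, hac, hbc⟩
      have h := eq_quadruple hS4 hS0 ha hb hc hab hac hbc
      refine ⟨?_, h.symm⟩
      obtain ⟨h1, h2, h3⟩ := fourth_ne hab hac hbc
      rwa [h, sum_quadruple f hab hac h1 hbc h2 h3] at hSf
  · rintro ⟨a, b, c⟩ h
    simp only [coe_filter, mem_univ, true_and, Set.mem_ofPred_eq] at h ⊢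
    obtain ⟨hab, hac, hbc⟩ := hdist a b c h
    obtain ⟨h1, h2, h3⟩ := fourth_ne hab hac hbc
    refine ⟨⟨card_quadruple hab hac hbc, sum_quadruple_eq_zero hab hac hbc⟩, ?_⟩
    rwa [sum_quadruple f hab hac h1 hbc h2 h3]

end Flats

/-! ### Counting affine permutations times transpositions -/

section Counting

variable {V : Type*} [AddCommGroup V] [Module (ZMod 2) V]

/-- The affine permutation with linear part `L` and translation part `d`. -/
def affinePerm (d : V) (L : V ≃ₗ[ZMod 2] V) : affinePerms V where
  val := L.toEquiv.trans (Equiv.addRight d)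
  property x y z := by
    simp only [Equiv.trans_apply, LinearEquiv.coe_toEquiv, Equiv.coe_addRight, map_add]
    grind [add_self_two d]

theorem affinePerm_bijective :
    Function.Bijective fun p : V × (V ≃ₗ[ZMod 2] V) => affinePerm p.1 p.2 := by
  constructor
  · rintro ⟨d, L⟩ ⟨e, M⟩ h
    have h' : ∀ x, L x + d = M x + e := fun x => DFunLike.congr_fun (congrArg Subtype.val h) x
    have hde : d = e := by simpa using h' 0
    subst hde
    have hLM : L = M := LinearEquiv.ext fun x => add_right_cancel (h' x)
    rw [hLM]
  · rintro ⟨A, hA⟩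
    let l : V →+ V :=
      { toFun := fun x => A x + A 0
        map_zero' := add_self_two _
        map_add' := fun x y => by
          have := hA x y 0
          rw [add_zero] at this
          rw [this]
          abel }
    have hl : Function.Bijective (l.toZModLinearMap 2) :=
      ((Equiv.addRight (A 0)).bijective).comp A.bijective
    refine ⟨(A 0, LinearEquiv.ofBijective _ hl), Subtype.ext (Equiv.ext fun x => ?_)⟩
    change A x + A 0 + A 0 = A x
    rw [add_assoc, add_self_two, add_zero]

theorem card_affinePerms (n : ℕ) :
    Nat.card (affinePerms (Fin n → ZMod 2)) = 2 ^ n * ∏ i ∈ range n, (2 ^ n - 2 ^ i) := by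
  rw [← Nat.card_congr (Equiv.ofBijective _ affinePerm_bijective), Nat.card_prod,
    ← Nat.card_congr (LinearMap.GeneralLinearGroup.generalLinearEquiv _ _).toEquiv,
    ← Nat.card_congr Matrix.GeneralLinearGroup.toLin.toEquiv, Matrix.card_GL_field,
    Nat.card_eq_fintype_card, ZMod.card, prod_range]
  simp

variable [Fintype V] [DecidableEq V]

omit [AddCommGroup V] [Module (ZMod 2) V] in
theorem card_swaps : Nat.card {t : Equiv.Perm V // t.IsSwap} = (Fintype.card V).choose 2 := by
  rcases Nat.lt_or_ge (Fintype.card V) 2 with h | h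
  · rw [Nat.choose_eq_zero_of_lt h, Nat.card_eq_zero]
    left
    refine ⟨fun ⟨t, a, b, hab, _⟩ => ?_⟩
    have := Fintype.card_le_one_iff.1 (by omega : Fintype.card V ≤ 1) a b
    exact hab this
  · have := Equiv.Perm.card_of_cycleType_singleton (α := V) le_rfl h
    rw [show Nat.factorial (2 - 1) = 1 from rfl, one_mul] at this
    rw [← this]
    refine Nat.subtype_card _ fun t => ?_
    rw [mem_filter, Equiv.Perm.isSwap_iff_cycleType]
    exact and_iff_right (mem_univ t)

/-- From At = Bs, the affine permutation B⁻¹A = st⁻¹ moves at most four points, fewer than half. -/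
theorem mul_swap_injective (hN : 8 < Fintype.card V) :
    Function.Injective fun p : affinePerms V × {t : Equiv.Perm V // t.IsSwap} =>
      (p.1 : Equiv.Perm V) * (p.2 : Equiv.Perm V) := by
  rintro ⟨⟨A, hA⟩, t, ht⟩ ⟨⟨B, hB⟩, s, hs⟩ h
  simp only at h
  have hBA : B⁻¹ * A = s * t⁻¹ := by
    rw [inv_mul_eq_iff_eq_mul, ← mul_assoc, ← h, mul_inv_cancel_right]
  have h1 : B⁻¹ * A = 1 := by
    refine eq_one_of_fixes (mul_mem (inv_mem hB) hA) (E := s.support ∪ t.support) ?_ ?_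
    · have := card_union_le s.support t.support
      rw [Equiv.Perm.card_support_eq_two.2 hs, Equiv.Perm.card_support_eq_two.2 ht] at this
      omega
    · intro x hx
      simp only [mem_union, Equiv.Perm.mem_support, not_or, not_not] at hx
      rw [hBA, Equiv.Perm.mul_apply, Equiv.Perm.inv_eq_iff_eq.2 hx.2.symm, hx.1]
  have hAB : A = B := (inv_mul_eq_one.1 h1).symm
  subst hAB
  have hst : t = s := mul_left_cancel h
  subst hst
  rfl

/-- Fixing 0 as one of the swapped points bounds the support by {0, u, w}, which is less than half
of eight points. General transpositions would not do there: in dimension three, (a b)(0 w) with a +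
b = w and disjoint pairs is affine. -/
theorem mul_swap_zero_injective (hN : 6 < Fintype.card V) :
    Function.Injective fun p : affinePerms V × {w : V // w ≠ 0} =>
      (p.1 : Equiv.Perm V) * Equiv.swap 0 (p.2 : V) := by
  rintro ⟨⟨A, hA⟩, w, hw⟩ ⟨⟨B, hB⟩, u, hu⟩ h
  simp only at h
  have hBA : B⁻¹ * A = Equiv.swap 0 u * Equiv.swap 0 w := by
    rw [inv_mul_eq_iff_eq_mul, ← mul_assoc, ← h, mul_assoc, Equiv.swap_mul_self, mul_one]
  have h1 : B⁻¹ * A = 1 := by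
    refine eq_one_of_fixes (mul_mem (inv_mem hB) hA) (E := {0, u, w}) ?_ ?_
    · have := card_le_three (a := 0) (b := u) (c := w)
      omega
    · intro x hx
      simp only [mem_insert, mem_singleton, not_or] at hx
      rw [hBA, Equiv.Perm.mul_apply, Equiv.swap_apply_of_ne_of_ne hx.1 hx.2.2,
        Equiv.swap_apply_of_ne_of_ne hx.1 hx.2.1]
  have hAB : A = B := (inv_mul_eq_one.1 h1).symm
  subst hAB
  have hst : w = u := by
    simpa using congrArg (fun t : Equiv.Perm V => t 0) (mul_left_cancel h)
  subst hst
  rfl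

theorem card_minimal_defect (hN : 12 < Fintype.card V) :
    Nat.card {f : Equiv.Perm V // defect f = 8 * (Fintype.card V - 2) * (Fintype.card V - 4)} =
      Nat.card (affinePerms V) * (Fintype.card V).choose 2 := by
  rw [← card_swaps, ← Nat.card_prod]
  have hmem : ∀ p : affinePerms V × {t : Equiv.Perm V // t.IsSwap},
      defect (p.1.1 * p.2.1) = 8 * (Fintype.card V - 2) * (Fintype.card V - 4) := by
    rintro ⟨⟨A, hA⟩, t, a, b, hab, rfl⟩
    exact defect_affine_mul_swap hA hab
  refine (Nat.card_congr (Equiv.ofBijective (fun p => ⟨p.1.1 * p.2.1, hmem p⟩) ⟨?_, ?_⟩)).symm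
  · intro p q h
    exact mul_swap_injective (by omega) (congrArg Subtype.val h)
  · rintro ⟨f, hf⟩
    obtain ⟨A, hA, t, ht, h⟩ := eq_affine_mul_swap (notMem_affinePerms (by omega) hf) hN hf.le
    exact ⟨⟨⟨A, hA⟩, t, ht⟩, Subtype.ext h⟩

theorem card_minimal_defect_of_card_eq_eight (hN : Fintype.card V = 8) :
    Nat.card {f : Equiv.Perm V // defect f = 8 * (Fintype.card V - 2) * (Fintype.card V - 4)} =
      Nat.card (affinePerms V) * 7 := by
  have h7 : Nat.card {w : V // w ≠ 0} = 7 := by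
    rw [Nat.card_eq_fintype_card, Fintype.card_subtype_compl, hN, Fintype.card_subtype_eq]
  rw [← h7, ← Nat.card_prod]
  have hmem : ∀ p : affinePerms V × {w : V // w ≠ 0},
      defect (p.1.1 * Equiv.swap 0 p.2.1) = 8 * (Fintype.card V - 2) * (Fintype.card V - 4) := by
    rintro ⟨⟨A, hA⟩, w, hw⟩
    exact defect_affine_mul_swap hA hw.symm
  refine (Nat.card_congr (Equiv.ofBijective
    (fun p => ⟨p.1.1 * Equiv.swap 0 p.2.1, hmem p⟩) ⟨?_, ?_⟩)).symm
  · intro p q h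
    exact mul_swap_zero_injective (by omega) (congrArg Subtype.val h)
  · rintro ⟨f, hf⟩
    obtain ⟨A, hA, w, hw, h⟩ :=
      eq_affine_mul_swap_zero (notMem_affinePerms (by omega) hf) hN hf.le
    exact ⟨⟨⟨A, hA⟩, w, hw⟩, Subtype.ext h⟩

end Counting

/-! ### Closed form of the count -/

theorem prod_two_pow_sub_two_pow (n : ℕ) :
    ∏ i ∈ range n, (2 ^ n - 2 ^ i) = 2 ^ (n * (n - 1) / 2) * ∏ j ∈ Icc 1 n, (2 ^ j - 1) := by
  have h : ∀ i ∈ range n, 2 ^ n - 2 ^ i = 2 ^ i * (2 ^ (n - 1 - i + 1) - 1) := by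
    intro i hi
    rw [mem_range] at hi
    rw [Nat.mul_sub, mul_one, ← pow_add]
    congr 2
    omega
  rw [prod_congr rfl h, prod_mul_distrib, prod_pow_eq_pow_sum, sum_range_id,
    prod_range_reflect (fun i => 2 ^ (i + 1) - 1) n, range_eq_Ico,
    prod_Ico_add' (fun j => 2 ^ j - 1) 0 n 1]
  rfl

/-- The exponents n, n(n-1)/2 and n-1 add up to (n²+3n-2)/2. One factor 2^n - 1 comes from the
binomial coefficient, the other is the top factor of the product. -/
theorem affine_mul_swap_count {n : ℕ} (hn : 1 ≤ n) :
    2 ^ n * (∏ i ∈ range n, (2 ^ n - 2 ^ i)) * (2 ^ n).choose 2 =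
      2 ^ ((n ^ 2 + 3 * n - 2) / 2) * (2 ^ n - 1) ^ 2 * ∏ j ∈ Icc 1 (n - 1), (2 ^ j - 1) := by
  obtain ⟨m, rfl⟩ := Nat.exists_eq_add_of_le' hn
  obtain ⟨k, hk⟩ := (Nat.even_mul_succ_self m).two_dvd
  have hchoose : (2 ^ (m + 1)).choose 2 = 2 ^ m * (2 ^ (m + 1) - 1) := by
    rw [Nat.choose_two_right, pow_succ, mul_comm (2 ^ m) 2, mul_assoc,
      Nat.mul_div_cancel_left _ two_pos]
  have e1 : (m + 1) * (m + 1 - 1) / 2 = k := by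
    rw [Nat.add_sub_cancel, mul_comm, hk, Nat.mul_div_cancel_left _ two_pos]
  have e2 : ((m + 1) ^ 2 + 3 * (m + 1) - 2) / 2 = (m + 1) + k + m := by
    have : (m + 1) ^ 2 + 3 * (m + 1) = 2 * k + 4 * m + 4 := by nlinarith
    omega
  rw [prod_two_pow_sub_two_pow, hchoose, e1, e2, prod_Icc_succ_top (by omega), Nat.add_sub_cancel,
    pow_add, pow_add]
  ring

theorem coaffinity_eq_iff {n : ℕ} (hn : 3 ≤ n) (f : Equiv.Perm (Fin n → ZMod 2)) :
    (coaffinity (ZMod 2) 2 f : ℚ) = 2 ^ 3 * qBinom 2 (n - 1) 2 ↔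
      defect f = 8 * (Fintype.card (Fin n → ZMod 2) - 2) * (Fintype.card (Fin n → ZMod 2) - 4) := by
  obtain ⟨m, rfl⟩ := Nat.exists_eq_add_of_le' hn
  have hq : qBinom 2 (m + 3 - 1) 2 = (4 * 2 ^ m - 1) * (2 * 2 ^ m - 1) / 3 := by
    rw [qBinom, prod_range_succ, prod_range_one, prod_range_succ, prod_range_one,
      show m + 3 - 1 - 0 = m + 2 by omega, show m + 3 - 1 - 1 = m + 1 by omega]
    norm_num [pow_add]
    ring
  have hc : Fintype.card (Fin (m + 3) → ZMod 2) = 8 * 2 ^ m := by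
    simp [pow_add, mul_comm]
  have hpos : 1 ≤ 2 ^ m := Nat.one_le_two_pow
  rw [hq, defect_eq_mul_coaffinity, hc, ← @Nat.cast_inj ℚ]
  push_cast [Nat.cast_sub (show 2 ≤ 8 * 2 ^ m by omega), Nat.cast_sub (show 4 ≤ 8 * 2 ^ m by omega)]
  constructor
  · intro h
    linear_combination 24 * h
  · intro h
    -- Both equations agree up to the factor 24, as (8/3)(N/2-1)(N/4-1) = (N-2)(N-4)/3.
    linear_combination h / 24

theorem corollary7p6 (n : ℕ) (hn : 3 ≤ n) :
    Nat.card {f : Equiv.Perm (Fin n → ZMod 2) //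
        (coaffinity (ZMod 2) 2 f : ℚ) = 2 ^ 3 * qBinom 2 (n - 1) 2} =
      if 4 ≤ n then
        2 ^ ((n ^ 2 + 3 * n - 2) / 2) * (2 ^ n - 1) ^ 2 *
          ∏ j ∈ Finset.Icc 1 (n - 1), (2 ^ j - 1)
      else 2 ^ 6 * 3 * 7 ^ 2 := by
  rw [Nat.card_congr (Equiv.subtypeEquivRight (coaffinity_eq_iff hn))]
  have hc : Fintype.card (Fin n → ZMod 2) = 2 ^ n := by simp
  split_ifs with h
  · have h16 : 2 ^ 4 ≤ 2 ^ n := Nat.pow_le_pow_right two_pos h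
    rw [card_minimal_defect (by omega), card_affinePerms, hc, affine_mul_swap_count (by omega)]
  · obtain rfl : n = 3 := by omega
    rw [card_minimal_defect_of_card_eq_eight hc, card_affinePerms]
    simp [prod_range_succ]
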